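/- Consider a Markov decision process with finite state space $\mathcal X$, finite action space $\mathcal A$, transition probabilities $P(x'\mid a,x)$ and reward function $r(x,a)$, a discount factor $\gamma\in(0,1)$, and a policy $\pi(a\mid x)$. Assume that the state chain with transition matrix $P_\pi(x'\mid x)=\sum_a P(x'\mid a,x)\pi(a\mid x)$ is irreducible and aperiodic, and let $\mu$ be its stationary distribution. Let $x_1\sim\mu$, $a_n\sim\pi(\cdot\mid x_n)$, $x_{n+1}\sim P(\cdot\mid a_n,x_n)$ for $n\ge1$. Let $\phi:\mathcal X\to\mathbb R^d$ be a feature map with $\|\phi(x)\|\le1$ (Euclidean norm) for all $x$, such that the matrix $\Phi$ with rows $\phi(x)^\top$ has full column rank. Let $\lambda_{\min}$ be the minimum eigenvalue of $\sum_x\mu(x)\phi(x)\phi(x)^\top$, and let $w_*$ be the solution of $$\mathbb E_\infty\left[\left(r(x,a)+\gamma\phi(x')^\top w-\phi(x)^\top w\right)\phi(x)\right]=0\quad\text{in } w\in\mathbb R^d,$$ where $x\sim\mu$, $a\sim\pi(\cdot\mid x)$, $x'\sim P(\cdot\mid a,x)$. Let $\alpha_1>0$, $$\alpha_n=\frac{\alpha_1}{\alpha_1\lambda_{\min}(1-\gamma)(n-1)+1}\qquad(n\ge1),$$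 let $R>0$ with $R\ge\|w_*\|$, and let $\Pi_R$ be the projection onto $\{w:\|w\|\le R\}$. Projected implicit TD(0) starts from a fixed $w_1\in\mathbb R^d$ and iterates $$w_{n+1}=\Pi_R\left(w_n+\frac{\alpha_n}{1+\alpha_n\|\phi(x_n)\|^2}\left(r(x_n,a_n)+\gamma\phi(x_{n+1})^\top w_n-\phi(x_n)^\top w_n\right)\phi(x_n)\right).$$ For constants $m>0$ and $\rho\in(0,1)$ let $\tau_\epsilon=\min\{n\ge1: m\rho^n\le\epsilon\}$. Then, for any such constants (in particular for those of the geometric mixing of the chain), there are a real $C$ and an integer $k\ge0$, not depending on $N$, such that for every $N>\tau_{\alpha_N}$ $$\mathbb E\|w_{N+1}-w_*\|^2\le C\,\frac{(\log N)^k}{N},$$ that is, $\mathbb E\|w_{N+1}-w_*\|^2=\tilde O(1/N)$. In particular, $\mathbb E\|w_{N+1}-w_*\|^2\to0$ as $N\to\infty$. -/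

import Mathlib

open MeasureTheory Filter Topology

noncomputable section

namespace ImplicitTD

/-- A Markov decision process with finite state space `X` and finite action space `A`:
`trans x a x'` is the probability `P(x' | a, x)` and `reward x a` is the reward `r(x, a)`
(bounded, since `X` and `A` are finite). -/
structure MDP (X A : Type*) [Fintype X] [Fintype A] where
  trans : X → A → X → ℝ
  trans_mem : ∀ x a, trans x a ∈ stdSimplex ℝ X
  reward : X → A → ℝ

/-- `π x a` is the probability `π(a | x)`. -/
def IsPolicy {X A : Type*} [Fintype A] (π : X → A → ℝ) : Prop :=
  ∀ x, π x ∈ stdSimplex ℝ A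

section Chain

variable {X A : Type*} [Fintype X] [Fintype A]

/-- The state transition matrix `P_π(x' | x) = ∑ a, P(x' | a, x) π(a | x)`. -/
def stateMatrix (M : MDP X A) (π : X → A → ℝ) : Matrix X X ℝ :=
  Matrix.of fun x x' => ∑ a, π x a * M.trans x a x'

/-- Every state has period one: the only common divisor of its possible return times is `1`. -/
def IsAperiodic [DecidableEq X] (P : Matrix X X ℝ) : Prop :=
  ∀ x, ∀ d : ℕ, (∀ n : ℕ, 1 ≤ n → 0 < (P ^ n) x x → d ∣ n) → d = 1

/-- `μ` is a stationary (steady-state) probability distribution of the transition matrix `P`. -/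
def IsStationary (P : Matrix X X ℝ) (μ : X → ℝ) : Prop :=
  μ ∈ stdSimplex ℝ X ∧ Matrix.vecMul μ P = μ

/-- The random states `x 1, x 2, …` and actions `a 1, a 2, …` are generated by the policy `π`
started from `x 1 ∼ μ`: `a n ∼ π(· | x n)` and `x (n + 1) ∼ P(· | a n, x n)`. This is expressed
through the joint law of `(x 1, a 1, …, x n, a n)` for each `n`. The values at index `0` are not
used. -/
structure IsTrajectory (M : MDP X A) (π : X → A → ℝ) (μ : X → ℝ)
    {Ω : Type*} [MeasurableSpace Ω] (ℙ : Measure Ω)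
    (x : ℕ → Ω → X) (a : ℕ → Ω → A) : Prop where
  measurable_state : ∀ n s, MeasurableSet {ω | x n ω = s}
  measurable_action : ∀ n b, MeasurableSet {ω | a n ω = b}
  law : ∀ n : ℕ, 1 ≤ n → ∀ (s : ℕ → X) (b : ℕ → A),
    ℙ.real {ω | ∀ i ∈ Finset.Icc 1 n, x i ω = s i ∧ a i ω = b i} =
      μ (s 1) * (∏ i ∈ Finset.Icc 1 n, π (s i) (b i)) *
        ∏ i ∈ Finset.Ico 1 n, M.trans (s i) (b i) (s (i + 1))

end Chain

section Features

variable {X A : Type*} [Fintype X] [Fintype A] {d : ℕ}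

/-- The matrix `Φ` whose row at the state `x` is the feature vector `φ(x)ᵀ`. -/
def featureMatrix (φ : X → EuclideanSpace ℝ (Fin d)) : Matrix X (Fin d) ℝ :=
  Matrix.of fun x i => φ x i

/-- The feature covariance matrix `Σ = ∑ x, μ(x) φ(x) φ(x)ᵀ`. -/
def featureCov (μ : X → ℝ) (φ : X → EuclideanSpace ℝ (Fin d)) : Matrix (Fin d) (Fin d) ℝ :=
  Matrix.of fun i j => ∑ x, μ x * (φ x i * φ x j)

/-- The minimum eigenvalue of the feature covariance matrix. -/
def lambdaMin (μ : X → ℝ) (φ : X → EuclideanSpace ℝ (Fin d)) : ℝ :=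
  sInf (spectrum ℝ (featureCov μ φ))

/-- The TD(0) error `r + γ φ(x')ᵀ w - φ(x)ᵀ w` for a transition from `x` to `x'` under the
action `a`. -/
def tdError (M : MDP X A) (γ : ℝ) (φ : X → EuclideanSpace ℝ (Fin d))
    (w : EuclideanSpace ℝ (Fin d)) (x : X) (a : A) (x' : X) : ℝ :=
  M.reward x a + γ * inner ℝ (φ x') w - inner ℝ (φ x) w

/-- The mean TD(0) direction `S(w) = E_∞[(r_n + γ φ_{n+1}ᵀ w - φ_nᵀ w) φ_n]` in steady state. -/
def meanTD (M : MDP X A) (π : X → A → ℝ) (μ : X → ℝ) (γ : ℝ)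
    (φ : X → EuclideanSpace ℝ (Fin d)) (w : EuclideanSpace ℝ (Fin d)) :
    EuclideanSpace ℝ (Fin d) :=
  ∑ x, ∑ a, ∑ x', (μ x * π x a * M.trans x a x') • (tdError M γ φ w x a x' • φ x)

/-- The projection `Π_R` onto the closed ball of radius `R` around the origin. -/
def projBall (R : ℝ) (w : EuclideanSpace ℝ (Fin d)) : EuclideanSpace ℝ (Fin d) :=
  open Classical in if R < ‖w‖ then (R / ‖w‖) • w else w

/-- The step sizes `α_n = α₁ / (α₁ λ (1 - γ) (n - 1) + 1)`, for `n ≥ 1`. -/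
def stepSize (α₁ lam γ : ℝ) (n : ℕ) : ℝ :=
  α₁ / (α₁ * lam * (1 - γ) * ((n : ℝ) - 1) + 1)

/-- One update of implicit TD(0), that is, the solution `w'` of
`w' = w + α (r + γ φ(x')ᵀ w - φ(x)ᵀ w') φ(x)`, in its explicit form. -/
def implicitStep (M : MDP X A) (γ : ℝ) (φ : X → EuclideanSpace ℝ (Fin d)) (α : ℝ)
    (w : EuclideanSpace ℝ (Fin d)) (x : X) (a : A) (x' : X) : EuclideanSpace ℝ (Fin d) :=
  w + (α / (1 + α * ‖φ x‖ ^ 2) * tdError M γ φ w x a x') • φ x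

/-- The iterates of projected implicit TD(0) along a trajectory of states `x 1, x 2, …` and
actions `a 1, a 2, …`, with step sizes `α 1, α 2, …`: `iterate … n` is the iterate `w_{n+1}`
reached after `n` updates from the initial guess `w₁`; the update from `w_n` to `w_{n+1}` uses
`α n`, `x n`, `a n` and `x (n + 1)`. -/
def iterate (M : MDP X A) (γ : ℝ) (φ : X → EuclideanSpace ℝ (Fin d)) (α : ℕ → ℝ) (R : ℝ)
    (w₁ : EuclideanSpace ℝ (Fin d)) (x : ℕ → X) (a : ℕ → A) : ℕ → EuclideanSpace ℝ (Fin d)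
  | 0 => w₁
  | n + 1 => projBall R (implicitStep M γ φ (α (n + 1)) (iterate M γ φ α R w₁ x a n)
      (x (n + 1)) (a (n + 1)) (x (n + 2)))

end Features

/-- The mixing time `τ_ε = min {n ∈ {1, 2, …} | m ρⁿ ≤ ε}` with constants `m > 0` and
`ρ ∈ (0, 1)`. -/
def mixingTime (m ρ ε : ℝ) : ℕ :=
  sInf {n : ℕ | 1 ≤ n ∧ m * ρ ^ n ≤ ε}

end ImplicitTD

end

/-!
The squared error `‖w_{n+1} - w_*‖²` satisfies a perturbed contraction. The projection does not
increase the distance to `w_*`, and the implicit step size `α / (1 + α ‖φ‖²)` differs from `α` by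
`O(α²)`, so one update acts like an explicit one up to `O(α²)`
(`sq_norm_projBall_implicitStep_le`). The mean TD(0) direction contracts towards `w_*` at the rate
`c = λ_min (1 - γ)`, because the transition operator is a contraction of `L²(μ)`
(`sum_mul_condTDInner_le`, with `lambdaMin_mul_sq_le` and `lambdaMin_pos`).

The remaining term is the bias from the Markovian sampling. Given the past, its conditional mean is
`h(x_n, w_n)` for a function `h` with `∑ x, μ(x) h(x, w) = 0` for each `w`. By irreducibility,
`1 - P + 𝟙 μᵀ` is invertible, so the Poisson equation `u(·, w) - P u(·, w) = h(·, w)` has a solution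
that depends smoothly on `w` (`exists_poisson_solution`, `exists_poisson_condTDInner`). By the
Markov property (`IsTrajectory.integral_transition`),
`E h(x_n, w_n) = E u(x_n, w_n) - E u(x_{n+1}, w_n)`, which is a difference of consecutive terms of
the sequence `E u(x_n, w_n)` up to `O(E ‖w_{n+1} - w_n‖) = O(α_n)`.

As `1 / α_{n+1} = 1 / α_n + c`, dividing the recursion by `α_n` turns it into a telescoping sum with
remainder `∑ α_n = O(log N)` (`exists_log_div_bound`). Hence the mean squared error is
`O(log N / N)`. The condition `N > τ` with `τ ≥ 1` guarantees `N ≥ 2`, where `log N` is bounded away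
from `0` and absorbs the constants. In dimension `0` the error vanishes.
-/

namespace ImplicitTD

/-! ### The projection onto the ball -/

section Projection

variable {d : ℕ}

lemma norm_projBall_le {R : ℝ} (hR : 0 < R) (v : EuclideanSpace ℝ (Fin d)) :
    ‖projBall R v‖ ≤ R := by
  unfold projBall
  split_ifs with h
  · rw [norm_smul, Real.norm_of_nonneg (by positivity), div_mul_cancel₀ _ (by linarith)]
  · exact not_lt.mp h

/-- The projection onto the ball does not increase the distance to any point of the ball. -/
lemma norm_projBall_sub_le {R : ℝ} (hR : 0 < R) (v : EuclideanSpace ℝ (Fin d))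
    {w : EuclideanSpace ℝ (Fin d)} (hw : ‖w‖ ≤ R) : ‖projBall R v - w‖ ≤ ‖v - w‖ := by
  unfold projBall
  split_ifs with h
  · have hv : 0 < ‖v‖ := hR.trans h
    obtain ⟨p, hp⟩ : ∃ p, p = (R / ‖v‖) • v := ⟨_, rfl⟩
    have hpn : ‖p‖ = R := by
      rw [hp, norm_smul, Real.norm_of_nonneg (by positivity), div_mul_cancel₀ _ hv.ne']
    have hvp : v = (‖v‖ / R) • p := by
      rw [hp, smul_smul, div_mul_div_cancel₀ hR.ne', div_self hv.ne', one_smul]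
    have hκ : 1 ≤ ‖v‖ / R := by rw [le_div_iff₀ hR]; linarith
    rw [← hp]
    generalize ‖v‖ / R = κ at hvp hκ
    refine (sq_le_sq₀ (norm_nonneg _) (norm_nonneg _)).1 ?_
    rw [hvp, norm_sub_sq_real, norm_sub_sq_real, norm_smul, inner_smul_left, hpn, mul_pow,
      Real.norm_eq_abs, sq_abs]
    have hpw : inner ℝ p w ≤ R * R :=
      (real_inner_le_norm p w).trans (by rw [hpn]; gcongr)
    simp only [conj_trivial]
    nlinarith [mul_le_mul_of_nonneg_left hpw (sub_nonneg.mpr hκ), mul_nonneg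
      (sub_nonneg.mpr hκ) (mul_nonneg (sub_nonneg.mpr hκ) (mul_nonneg hR.le hR.le))]
  · exact le_rfl

end Projection

/-! ### The Poisson equation of an irreducible chain -/

section Poisson

variable {X : Type*} [Fintype X] [DecidableEq X] {P : Matrix X X ℝ} {μ : X → ℝ}

lemma IsStationary.vecMul_pow (hμ : IsStationary P μ) (k : ℕ) :
    Matrix.vecMul μ (P ^ k) = μ := by
  induction k with
  | zero => simp
  | succ k ih => rw [pow_succ, ← Matrix.vecMul_vecMul, ih, hμ.2]

lemma IsStationary.pos (hμ : IsStationary P μ) (hirr : P.IsIrreducible) (x : X) : 0 < μ x := by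
  obtain ⟨y, hy⟩ : ∃ y, 0 < μ y := by
    by_contra! h
    have h1 := hμ.1.2
    have h2 : ∑ y, μ y ≤ 0 := Finset.sum_nonpos fun y _ => h y
    linarith
  obtain ⟨k, -, hk⟩ := (Matrix.isIrreducible_iff_exists_pow_pos hirr.nonneg).1 hirr y x
  have hpow : ∀ i j, 0 ≤ (P ^ k) i j := Matrix.pow_apply_nonneg hirr.nonneg k
  rw [← hμ.vecMul_pow k]
  exact Finset.sum_pos' (fun i _ => mul_nonneg (hμ.1.1 i) (hpow i x))
    ⟨y, Finset.mem_univ y, mul_pos hy hk⟩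

/-- The maximum principle: a harmonic function of an irreducible stochastic matrix is constant. -/
lemma harmonic_eq (hirr : P.IsIrreducible) (hP : ∀ x, ∑ y, P x y = 1) {u : X → ℝ}
    (hu : Matrix.mulVec P u = u) (x y : X) : u x = u y := by
  obtain ⟨z, hz⟩ := haveI : Nonempty X := ⟨x⟩; Finite.exists_max u
  have hone : ∀ k : ℕ, Matrix.mulVec (P ^ k) 1 = 1 := by
    intro k
    induction k with
    | zero => simp
    | succ k ih =>
      rw [pow_succ, ← Matrix.mulVec_mulVec, show Matrix.mulVec P 1 = 1 from ?_, ih]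
      ext i
      simpa [Matrix.mulVec, dotProduct] using hP i
  have hpow : ∀ k : ℕ, Matrix.mulVec (P ^ k) u = u := by
    intro k
    induction k with
    | zero => simp
    | succ k ih => rw [pow_succ, ← Matrix.mulVec_mulVec, hu, ih]
  suffices h : ∀ y, u y = u z by rw [h x, h y]
  intro y
  obtain ⟨k, -, hk⟩ := (Matrix.isIrreducible_iff_exists_pow_pos hirr.nonneg).1 hirr z y
  have hnn : ∀ i j, 0 ≤ (P ^ k) i j := Matrix.pow_apply_nonneg hirr.nonneg k
  have hsum : ∑ i, (P ^ k) z i * (u z - u i) = 0 := by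
    have h1 := congrFun (hone k) z
    have h2 := congrFun (hpow k) z
    simp only [Matrix.mulVec, dotProduct, Pi.one_apply, mul_one] at h1 h2
    simp only [mul_sub, Finset.sum_sub_distrib, h2, ← Finset.sum_mul, h1, one_mul, sub_self]
  have h0 := (Finset.sum_eq_zero_iff_of_nonneg fun i _ =>
    mul_nonneg (hnn z i) (sub_nonneg.2 (hz i))).1 hsum y (Finset.mem_univ y)
  rcases mul_eq_zero.1 h0 with h | h
  · exact absurd h hk.ne'
  · linarith

/-- The Poisson equation `u - P u = h` has a solution for each `h` of stationary mean zero, and the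
solution can be chosen linear in `h`: `Q` is the fundamental matrix `(1 - P + 𝟙 μᵀ)⁻¹`. -/
lemma exists_poisson_solution (hirr : P.IsIrreducible) (hP : ∀ x, ∑ y, P x y = 1)
    (hμ : IsStationary P μ) :
    ∃ Q : Matrix X X ℝ, ∀ h : X → ℝ, μ ⬝ᵥ h = 0 →
      ∀ x, h x = Matrix.mulVec Q h x - Matrix.mulVec P (Matrix.mulVec Q h) x := by
  obtain ⟨Z, hZ⟩ : ∃ Z : Matrix X X ℝ, Z = 1 - P + Matrix.vecMulVec 1 μ := ⟨_, rfl⟩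
  have hZu : ∀ u, Matrix.mulVec Z u = u - Matrix.mulVec P u + fun _ => μ ⬝ᵥ u := by
    intro u
    rw [hZ, Matrix.add_mulVec, Matrix.sub_mulVec, Matrix.one_mulVec]
    congr 1
    ext i
    simp [Matrix.vecMulVec, Matrix.mulVec, dotProduct]
  have hμZ : ∀ u, μ ⬝ᵥ Matrix.mulVec Z u = μ ⬝ᵥ u := by
    intro u
    have h1 : (μ ⬝ᵥ fun _ => μ ⬝ᵥ u) = μ ⬝ᵥ u := by
      simp only [dotProduct, ← Finset.sum_mul, hμ.1.2, one_mul]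
    rw [hZu, dotProduct_add, dotProduct_sub, Matrix.dotProduct_mulVec, hμ.2, h1]
    ring
  have hinj : Function.Injective (Matrix.mulVec Z) := by
    refine (injective_iff_map_eq_zero (Matrix.mulVecLin Z)).2 fun u hu => ?_
    rw [Matrix.mulVecLin_apply] at hu
    have h0 : μ ⬝ᵥ u = 0 := by rw [← hμZ, hu, dotProduct_zero]
    have hPu : Matrix.mulVec P u = u := by
      have h2 := hZu u
      rw [hu, h0] at h2
      ext i
      have := congrFun h2 i
      simp only [Pi.zero_apply, Pi.add_apply, Pi.sub_apply] at this
      linarith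
    ext i
    have hc : μ ⬝ᵥ u = u i := by
      rw [dotProduct, Finset.sum_congr rfl fun j _ => by rw [harmonic_eq hirr hP hPu j i],
        ← Finset.sum_mul, hμ.1.2, one_mul]
    simpa [hc] using h0
  have hunit : IsUnit Z := Matrix.mulVec_injective_iff_isUnit.1 hinj
  refine ⟨Z⁻¹, fun h hh x => ?_⟩
  have h1 : Matrix.mulVec Z (Matrix.mulVec Z⁻¹ h) = h := by
    rw [Matrix.mulVec_mulVec, Matrix.mul_nonsing_inv _ ((Matrix.isUnit_iff_isUnit_det _).1 hunit),
      Matrix.one_mulVec]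
  have h0 : μ ⬝ᵥ Matrix.mulVec Z⁻¹ h = 0 := by rw [← hμZ, h1, hh]
  have h2 := congrFun (hZu (Matrix.mulVec Z⁻¹ h)) x
  rw [h1, h0] at h2
  simpa using h2

end Poisson

/-! ### The feature covariance matrix -/

section Covariance

variable {X : Type*} [Fintype X] {d : ℕ} {μ : X → ℝ} {φ : X → EuclideanSpace ℝ (Fin d)}

lemma isHermitian_featureCov : (featureCov μ φ).IsHermitian := by
  ext i j
  simp only [featureCov, Matrix.conjTranspose_apply, Matrix.of_apply, star_trivial]
  exact Finset.sum_congr rfl fun x _ => by ring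

lemma dotProduct_featureCov_mulVec (v : Fin d → ℝ) :
    v ⬝ᵥ Matrix.mulVec (featureCov μ φ) v = ∑ x, μ x * (φ x ⬝ᵥ v) ^ 2 := by
  simp only [featureCov, dotProduct, Matrix.mulVec, Matrix.of_apply, Finset.mul_sum,
    Finset.sum_mul, sq]
  simp_rw [Finset.sum_comm (s := (Finset.univ : Finset (Fin d))) (t := (Finset.univ : Finset X))]
  refine Finset.sum_congr rfl fun x _ => ?_
  rw [Finset.sum_comm]
  exact Finset.sum_congr rfl fun i _ => Finset.sum_congr rfl fun j _ => by ring

/-- The minimum eigenvalue bounds the quadratic form of the feature covariance from below. -/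
lemma lambdaMin_mul_sq_le (v : EuclideanSpace ℝ (Fin d)) :
    lambdaMin μ φ * ‖v‖ ^ 2 ≤ ∑ x, μ x * (inner ℝ (φ x) v) ^ 2 := by
  have hH : (featureCov μ φ).IsHermitian := isHermitian_featureCov
  have hpsd : (featureCov μ φ - algebraMap ℝ _ (lambdaMin μ φ)).PosSemidef := by
    rw [Matrix.posSemidef_iff_isHermitian_and_spectrum_nonneg]
    refine ⟨hH.sub ?_, fun t ht => ?_⟩
    · rw [Matrix.algebraMap_eq_diagonal]
      exact Matrix.isHermitian_diagonal _
    · have ht' : t + lambdaMin μ φ ∈ spectrum ℝ (featureCov μ φ) := by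
        have := (spectrum.add_mem_add_iff (r := t) (s := lambdaMin μ φ)).2 ht
        simpa [add_comm] using this
      have hbdd : BddBelow (spectrum ℝ (featureCov μ φ)) :=
        (Matrix.finite_real_spectrum (A := featureCov μ φ)).bddBelow
      have := csInf_le hbdd ht'
      exact nonneg_of_le_add_left this
  have h := hpsd.dotProduct_mulVec_nonneg (v : Fin d → ℝ)
  rw [Matrix.sub_mulVec, dotProduct_sub, star_trivial, dotProduct_featureCov_mulVec,
    Algebra.algebraMap_eq_smul_one, Matrix.smul_mulVec, Matrix.one_mulVec, dotProduct_smul] at h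
  have hn : (v : Fin d → ℝ) ⬝ᵥ (v : Fin d → ℝ) = ‖v‖ ^ 2 := by
    rw [EuclideanSpace.real_norm_sq_eq]
    simp [dotProduct, sq]
  rw [hn, smul_eq_mul] at h
  have hi : ∀ x, inner ℝ (φ x) v = (φ x : Fin d → ℝ) ⬝ᵥ (v : Fin d → ℝ) := fun x => by
    simp [PiLp.inner_apply, dotProduct, mul_comm]
  simp_rw [hi]
  linarith

lemma lambdaMin_pos (hμ : ∀ x, 0 < μ x) (hrank : (featureMatrix φ).rank = d) (hd : 0 < d) :
    0 < lambdaMin μ φ := by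
  have hinj : Function.Injective (Matrix.mulVec (featureMatrix φ)) := by
    have hker : Module.finrank ℝ (LinearMap.ker (featureMatrix φ).mulVecLin) = 0 := by
      have h := LinearMap.finrank_range_add_finrank_ker (featureMatrix φ).mulVecLin
      have hr : Module.finrank ℝ (LinearMap.range (featureMatrix φ).mulVecLin) = d := hrank
      rw [hr, Module.finrank_fin_fun] at h
      omega
    exact LinearMap.ker_eq_bot.1 (Submodule.finrank_eq_zero.1 hker)
  have hH : (featureCov μ φ).IsHermitian := isHermitian_featureCov
  have hpd : (featureCov μ φ).PosDef := by
    refine Matrix.PosDef.of_dotProduct_mulVec_pos hH fun v hv => ?_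
    rw [star_trivial, dotProduct_featureCov_mulVec]
    obtain ⟨x, hx⟩ : ∃ x, (φ x : Fin d → ℝ) ⬝ᵥ v ≠ 0 := by
      by_contra! h
      refine hv (hinj ?_)
      ext x
      simpa [Matrix.mulVec, featureMatrix, dotProduct] using h x
    exact Finset.sum_pos' (fun y _ => mul_nonneg (hμ y).le (sq_nonneg _))
      ⟨x, Finset.mem_univ x, mul_pos (hμ x) (by positivity)⟩
  have hne : (spectrum ℝ (featureCov μ φ)).Nonempty :=
    ⟨_, hH.eigenvalues_mem_spectrum_real ⟨0, hd⟩⟩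
  have hmem := hne.csInf_mem (Matrix.finite_real_spectrum (A := featureCov μ φ))
  rw [hH.spectrum_real_eq_range_eigenvalues] at hmem
  obtain ⟨i, hi⟩ := hmem
  rw [lambdaMin, hH.spectrum_real_eq_range_eigenvalues, ← hi]
  exact hH.posDef_iff_eigenvalues_pos.1 hpd i

end Covariance

/-! ### Expectations along the trajectory -/

section FiniteValued

lemma comp_eq_sum_indicator {Ω T : Type*} [Fintype T] (V : Ω → T) (F : T → ℝ) :
    (fun ω => F (V ω)) = fun ω => ∑ t, {ω | V ω = t}.indicator (fun _ => F t) ω := by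
  classical
  ext ω
  simp [Set.indicator_apply]

variable {Ω T : Type*} [MeasurableSpace Ω] {ℙ : Measure Ω} [IsProbabilityMeasure ℙ] [Fintype T]
  {V : Ω → T}

lemma integrable_comp_of_finite (hV : ∀ t, MeasurableSet {ω | V ω = t}) (F : T → ℝ) :
    Integrable (fun ω => F (V ω)) ℙ := by
  rw [comp_eq_sum_indicator V F]
  exact integrable_finsetSum _ fun t _ => (integrable_const _).indicator (hV t)

lemma integral_comp_of_finite (hV : ∀ t, MeasurableSet {ω | V ω = t}) (F : T → ℝ) :
    ∫ ω, F (V ω) ∂ℙ = ∑ t, ℙ.real {ω | V ω = t} * F t := by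
  rw [comp_eq_sum_indicator V F,
    integral_finsetSum _ fun t _ => (integrable_const _).indicator (hV t)]
  exact Finset.sum_congr rfl fun t _ => by rw [integral_indicator_const _ (hV t), smul_eq_mul]

lemma measureReal_eq_sum_fiber (hV : ∀ t, MeasurableSet {ω | V ω = t}) (E : Set Ω) :
    ℙ.real E = ∑ t, ℙ.real ({ω | V ω = t} ∩ E) := by
  have h : (⋃ t ∈ (Finset.univ : Finset T), {ω | V ω = t}) = Set.univ := by
    ext ω
    simp
  rw [← measureReal_restrict_apply_univ, ← h, measureReal_biUnion_finset _ fun t _ => hV t]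
  · exact Finset.sum_congr rfl fun t _ => measureReal_restrict_apply (hV t)
  · exact fun t _ t' _ htt' => Set.disjoint_left.2 fun ω h1 h2 => htt' (h1.symm.trans h2)

end FiniteValued

section History

variable {X A Ω : Type*} {x : ℕ → Ω → X} {a : ℕ → Ω → A}

/-- The history `(x 1, a 1, …, x n, a n)`; the entry at `i : Fin n` is `(x (i + 1), a (i + 1))`. -/
def hist (x : ℕ → Ω → X) (a : ℕ → Ω → A) (n : ℕ) (ω : Ω) : Fin n → X × A :=
  fun i => (x (i + 1) ω, a (i + 1) ω)

lemma hist_eq_iff {n : ℕ} {ω : Ω} {s : ℕ → X} {b : ℕ → A} :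
    (hist x a n ω = fun i : Fin n => (s (i + 1), b (i + 1))) ↔
      ∀ i ∈ Finset.Icc 1 n, x i ω = s i ∧ a i ω = b i := by
  simp only [hist, funext_iff, Prod.mk.injEq, Finset.mem_Icc]
  constructor
  · intro h i hi
    obtain ⟨j, rfl⟩ : ∃ j, i = j + 1 := ⟨i - 1, by omega⟩
    exact h ⟨j, by omega⟩
  · intro h i
    exact h _ ⟨by omega, by omega⟩

/-- The iterate after `n` updates is determined by the history up to time `n` and `x (n + 1)`. -/
lemma exists_iterate_eq [Fintype X] [Fintype A] (x : ℕ → Ω → X) (a : ℕ → Ω → A) {d : ℕ}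
    (M : MDP X A) (γ : ℝ) (φ : X → EuclideanSpace ℝ (Fin d)) (α : ℕ → ℝ) (R : ℝ)
    (w₁ : EuclideanSpace ℝ (Fin d)) (n : ℕ) :
    ∃ W : (Fin n → X × A) → X → EuclideanSpace ℝ (Fin d), ∀ ω : Ω,
      iterate M γ φ α R w₁ (fun n => x n ω) (fun n => a n ω) n =
        W (hist x a n ω) (x (n + 1) ω) := by
  induction n with
  | zero => exact ⟨fun _ _ => w₁, fun ω => rfl⟩
  | succ n ih =>
    obtain ⟨W, hW⟩ := ih
    refine ⟨fun t s' => projBall R (implicitStep M γ φ (α (n + 1))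
      (W (Fin.init t) (t (Fin.last n)).1) (t (Fin.last n)).1 (t (Fin.last n)).2 s'), fun ω => ?_⟩
    rw [iterate, hW]
    rfl

end History

section Markov

variable {X A : Type*} [Fintype X] [Fintype A] {M : MDP X A} {π : X → A → ℝ} {μ : X → ℝ}
  {Ω : Type*} [MeasurableSpace Ω] {ℙ : Measure Ω} {x : ℕ → Ω → X} {a : ℕ → Ω → A}

lemma IsTrajectory.measurableSet_hist (h : IsTrajectory M π μ ℙ x a) (n : ℕ)
    (t : Fin n → X × A) : MeasurableSet {ω | hist x a n ω = t} := by
  have : {ω | hist x a n ω = t} =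
      ⋂ i : Fin n, {ω | x (i + 1) ω = (t i).1} ∩ {ω | a (i + 1) ω = (t i).2} := by
    ext ω
    simp [hist, funext_iff, Prod.ext_iff]
  rw [this]
  exact MeasurableSet.iInter fun i => (h.measurable_state _ _).inter (h.measurable_action _ _)

lemma IsTrajectory.measurableSet_transition (h : IsTrajectory M π μ ℙ x a) (n : ℕ)
    (t : (Fin n → X × A) × X × A × X) :
    MeasurableSet {ω | (hist x a n ω, x (n + 1) ω, a (n + 1) ω, x (n + 2) ω) = t} := by
  simp only [Prod.ext_iff]
  exact (h.measurableSet_hist n _).inter ((h.measurable_state _ _).inter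
    ((h.measurable_action _ _).inter (h.measurable_state _ _)))

lemma IsTrajectory.measurableSet_hist_state (h : IsTrajectory M π μ ℙ x a) (n : ℕ)
    (t : (Fin n → X × A) × X) :
    MeasurableSet {ω | (hist x a n ω, x (n + 1) ω) = t} := by
  simp only [Prod.ext_iff]
  exact (h.measurableSet_hist n _).inter (h.measurable_state _ _)

variable [IsProbabilityMeasure ℙ]

/-- The joint law of `x 1, a 1, …, x n, a n, x (n + 1)`. -/
lemma IsTrajectory.law_state (h : IsTrajectory M π μ ℙ x a) (hπ : IsPolicy π) (n : ℕ)
    (s : ℕ → X) (b : ℕ → A) :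
    ℙ.real {ω | (∀ i ∈ Finset.Icc 1 n, x i ω = s i ∧ a i ω = b i) ∧ x (n + 1) ω = s (n + 1)} =
      μ (s 1) * (∏ i ∈ Finset.Icc 1 n, π (s i) (b i)) *
        ∏ i ∈ Finset.Ico 1 (n + 1), M.trans (s i) (b i) (s (i + 1)) := by
  rw [measureReal_eq_sum_fiber (h.measurable_action (n + 1)) {ω | _}]
  have key : ∀ c, ℙ.real ({ω | a (n + 1) ω = c} ∩ {ω | (∀ i ∈ Finset.Icc 1 n, x i ω = s i ∧ a i ω = b i) ∧
      x (n + 1) ω = s (n + 1)}) =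
      μ (s 1) * (∏ i ∈ Finset.Icc 1 n, π (s i) (b i)) *
        (∏ i ∈ Finset.Ico 1 (n + 1), M.trans (s i) (b i) (s (i + 1))) * π (s (n + 1)) c := by
    intro c
    have hne : ∀ i ≤ n, Function.update b (n + 1) c i = b i := fun i hi =>
      Function.update_of_ne (by omega) _ _
    have hl := h.law (n + 1) (by omega) s (Function.update b (n + 1) c)
    rw [Finset.prod_Icc_succ_top (by omega), Function.update_self,
      Finset.prod_congr rfl fun i hi => by rw [hne i (Finset.mem_Icc.1 hi).2],
      Finset.prod_congr (s₁ := Finset.Ico 1 (n + 1)) rfl fun i hi => by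
        rw [hne i (by have := (Finset.mem_Ico.1 hi).2; omega)]] at hl
    calc _ = _ := by
          congr 1
          ext ω
          simp only [Set.mem_inter_iff, Set.mem_ofPred_eq, Finset.mem_Icc]
          constructor
          · rintro ⟨h3, h1, h2⟩ i ⟨hi1, hi2⟩
            rcases Nat.lt_or_ge n i with hi | hi
            · obtain rfl : i = n + 1 := by omega
              exact ⟨h2, by rw [h3, Function.update_self]⟩
            · rw [hne i hi]
              exact h1 i ⟨hi1, hi⟩
          · intro h1
            have h2 := h1 (n + 1) ⟨by omega, le_rfl⟩
            rw [Function.update_self] at h2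
            refine ⟨h2.2, fun i hi => ?_, h2.1⟩
            have h3 := h1 i ⟨hi.1, by omega⟩
            rwa [hne i hi.2] at h3
      _ = _ := hl
      _ = _ := by ring
  rw [Finset.sum_congr rfl fun c _ => key c, ← Finset.mul_sum, (hπ _).2, mul_one]

/-- The Markov property of the trajectory: given the history and the state `x (n + 1)`, the action
has law `π` and the next state has law `P`. -/
lemma IsTrajectory.real_transition (h : IsTrajectory M π μ ℙ x a) (hπ : IsPolicy π) (n : ℕ)
    (t : Fin n → X × A) (s : X) (b : A) (s' : X) :
    ℙ.real {ω | (hist x a n ω, x (n + 1) ω, a (n + 1) ω, x (n + 2) ω) = (t, s, b, s')} =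
      ℙ.real {ω | (hist x a n ω, x (n + 1) ω) = (t, s)} * (π s b * M.trans s b s') := by
  obtain ⟨S, B, hSB, hS, hB, hS'⟩ : ∃ (S : ℕ → X) (B : ℕ → A),
      t = (fun i : Fin n => (S (i + 1), B (i + 1))) ∧ S (n + 1) = s ∧ B (n + 1) = b ∧
        S (n + 2) = s' := by
    refine ⟨fun i => if hi : 1 ≤ i ∧ i ≤ n then (t ⟨i - 1, by omega⟩).1 else
      if i = n + 1 then s else s', fun i => if hi : 1 ≤ i ∧ i ≤ n then (t ⟨i - 1, by omega⟩).2
      else b, ?_, by simp, by simp, by simp⟩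
    ext i <;> simp [Nat.succ_le_of_lt i.2]
  subst hSB hS hB hS'
  simp only [Prod.mk.injEq]
  have h2 := h.law_state hπ (n + 1) S B
  rw [Finset.prod_Icc_succ_top (by omega), Finset.prod_Ico_succ_top (by omega)] at h2
  have h1 := h.law_state hπ n S B
  simp only [← hist_eq_iff] at h1 h2
  rw [h1]
  calc _ = _ := by
        congr 1
        ext ω
        simp only [Set.mem_ofPred_eq]
        simp only [hist, funext_iff, Fin.forall_fin_succ', Fin.val_castSucc, Fin.val_last,
          Prod.mk.injEq]
        tauto
    _ = _ := h2
    _ = _ := by ring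

variable {d : ℕ} {γ R : ℝ} {φ : X → EuclideanSpace ℝ (Fin d)} {α : ℕ → ℝ}
  {w₁ : EuclideanSpace ℝ (Fin d)}

lemma IsTrajectory.integrable_iterate (h : IsTrajectory M π μ ℙ x a) (n : ℕ)
    (G : EuclideanSpace ℝ (Fin d) → X → A → X → ℝ) :
    Integrable (fun ω => G (iterate M γ φ α R w₁ (fun n => x n ω) (fun n => a n ω) n)
      (x (n + 1) ω) (a (n + 1) ω) (x (n + 2) ω)) ℙ := by
  obtain ⟨W, hW⟩ := exists_iterate_eq x a M γ φ α R w₁ n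
  simp_rw [hW]
  exact integrable_comp_of_finite (h.measurableSet_transition n)
    fun t => G (W t.1 t.2.1) t.2.1 t.2.2.1 t.2.2.2

/-- Averaging out the action and the next state, which are drawn from `π` and `P` independently of
how the current iterate was reached. -/
lemma IsTrajectory.integral_transition (h : IsTrajectory M π μ ℙ x a) (hπ : IsPolicy π) (n : ℕ)
    (G : EuclideanSpace ℝ (Fin d) → X → A → X → ℝ) :
    ∫ ω, G (iterate M γ φ α R w₁ (fun n => x n ω) (fun n => a n ω) n)
        (x (n + 1) ω) (a (n + 1) ω) (x (n + 2) ω) ∂ℙ =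
      ∫ ω, ∑ b, ∑ s', π (x (n + 1) ω) b * M.trans (x (n + 1) ω) b s' *
        G (iterate M γ φ α R w₁ (fun n => x n ω) (fun n => a n ω) n) (x (n + 1) ω) b s' ∂ℙ := by
  obtain ⟨W, hW⟩ := exists_iterate_eq x a M γ φ α R w₁ n
  simp_rw [hW]
  rw [integral_comp_of_finite (h.measurableSet_transition n)
      fun t => G (W t.1 t.2.1) t.2.1 t.2.2.1 t.2.2.2,
    integral_comp_of_finite (h.measurableSet_hist_state n)
      fun t => ∑ b, ∑ s', π t.2 b * M.trans t.2 b s' * G (W t.1 t.2) t.2 b s']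
  simp only [Fintype.sum_prod_type, h.real_transition hπ, Finset.mul_sum]
  refine Finset.sum_congr rfl fun t _ => Finset.sum_congr rfl fun s _ =>
    Finset.sum_congr rfl fun b _ => Finset.sum_congr rfl fun s' _ => by ring

end Markov

/-! ### The mean TD(0) direction -/

section MeanDirection

variable {X A : Type*} [Fintype X] [Fintype A] {d : ℕ}

/-- The inner product of the semi-gradient `δ φ(s)` of a transition with `w - w_*`, where `δ` is the
TD(0) error. -/
noncomputable def tdInner (M : MDP X A) (γ : ℝ) (φ : X → EuclideanSpace ℝ (Fin d))
    (wStar w : EuclideanSpace ℝ (Fin d)) (s : X) (b : A) (s' : X) : ℝ :=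
  tdError M γ φ w s b s' * inner ℝ (φ s) (w - wStar)

/-- The conditional mean of `tdInner` given the current iterate `w` and the current state `s`. -/
noncomputable def condTDInner (M : MDP X A) (π : X → A → ℝ) (γ : ℝ) (φ : X → EuclideanSpace ℝ (Fin d))
    (wStar w : EuclideanSpace ℝ (Fin d)) (s : X) : ℝ :=
  ∑ b, ∑ s', π s b * M.trans s b s' * tdInner M γ φ wStar w s b s'

variable {M : MDP X A} {π : X → A → ℝ} {μ : X → ℝ} {γ : ℝ}
  {φ : X → EuclideanSpace ℝ (Fin d)} {wStar : EuclideanSpace ℝ (Fin d)}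

lemma sum_stateMatrix (hπ : IsPolicy π) (s : X) : ∑ s', stateMatrix M π s s' = 1 := by
  simp only [stateMatrix, Matrix.of_apply]
  rw [Finset.sum_comm]
  simp only [← Finset.mul_sum, (M.trans_mem s _).2, mul_one, (hπ s).2]

lemma sum_mul_condTDInner (w : EuclideanSpace ℝ (Fin d)) :
    ∑ s, μ s * condTDInner M π γ φ wStar w s = inner ℝ (meanTD M π μ γ φ w) (w - wStar) := by
  simp only [condTDInner, tdInner, meanTD, sum_inner, real_inner_smul_left, Finset.mul_sum]
  refine Finset.sum_congr rfl fun s _ => Finset.sum_congr rfl fun b _ =>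
    Finset.sum_congr rfl fun s' _ => by ring

lemma contDiff_condTDInner (s : X) :
    ContDiff ℝ 1 fun w => condTDInner M π γ φ wStar w s := by
  have h : ∀ s, ContDiff ℝ 1 fun w => inner ℝ (φ s) w := fun s => contDiff_const.inner ℝ contDiff_id
  unfold condTDInner tdInner tdError
  simp only [inner_sub_right]
  fun_prop

/-- The mean TD(0) direction points towards its zero `w_*`, because the transition operator is a
contraction of `L²(μ)`. -/
lemma sum_mul_condTDInner_le (hπ : IsPolicy π) (hμ : IsStationary (stateMatrix M π) μ)
    (hγ0 : 0 ≤ γ) (hγ1 : γ ≤ 1) (hwStar : meanTD M π μ γ φ wStar = 0)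
    (w : EuclideanSpace ℝ (Fin d)) :
    ∑ s, μ s * condTDInner M π γ φ wStar w s ≤ -(lambdaMin μ φ * (1 - γ) * ‖w - wStar‖ ^ 2) := by
  set v : X → ℝ := fun s => inner ℝ (φ s) (w - wStar) with hv
  have hp : ∀ s b s', 0 ≤ μ s * π s b * M.trans s b s' := fun s b s' =>
    mul_nonneg (mul_nonneg (hμ.1.1 s) ((hπ s).1 b)) ((M.trans_mem s b).1 s')
  have h1 : ∑ s, μ s * condTDInner M π γ φ wStar w s =
      ∑ s, ∑ b, ∑ s', μ s * π s b * M.trans s b s' * ((γ * v s' - v s) * v s) := by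
    have h0 : inner ℝ (meanTD M π μ γ φ wStar) (w - wStar) = 0 := by rw [hwStar, inner_zero_left]
    rw [sum_mul_condTDInner, ← sub_zero (inner ℝ _ _), ← h0, ← inner_sub_left]
    simp only [meanTD, ← Finset.sum_sub_distrib, sum_inner, ← smul_sub, ← sub_smul,
      real_inner_smul_left]
    refine Finset.sum_congr rfl fun s _ => Finset.sum_congr rfl fun b _ =>
      Finset.sum_congr rfl fun s' _ => ?_
    simp only [tdError, hv, inner_sub_right]
    ring
  have h2 : ∑ s, ∑ b, ∑ s', μ s * π s b * M.trans s b s' * v s' ^ 2 = ∑ s, μ s * v s ^ 2 := by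
    have hst : ∀ s', μ s' = ∑ s, μ s * stateMatrix M π s s' := fun s' =>
      (congrFun hμ.2 s').symm
    calc _ = ∑ s', (∑ s, μ s * stateMatrix M π s s') * v s' ^ 2 := by
          simp only [stateMatrix, Matrix.of_apply, Finset.mul_sum, Finset.sum_mul]
          rw [Finset.sum_comm (s := (Finset.univ : Finset X)) (t := (Finset.univ : Finset X))]
          refine Finset.sum_congr rfl fun s _ => ?_
          rw [Finset.sum_comm]
          exact Finset.sum_congr rfl fun s' _ => Finset.sum_congr rfl fun b _ => by ring
      _ = _ := Finset.sum_congr rfl fun s' _ => by rw [← hst s']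
  have h3 : ∑ s, ∑ b, ∑ s', μ s * π s b * M.trans s b s' * v s ^ 2 = ∑ s, μ s * v s ^ 2 := by
    refine Finset.sum_congr rfl fun s _ => ?_
    simp only [← Finset.sum_mul, ← Finset.mul_sum, (M.trans_mem s _).2, mul_one, (hπ s).2]
  have h4 : ∑ s, ∑ b, ∑ s', μ s * π s b * M.trans s b s' * ((γ * v s' - v s) * v s) ≤
      γ / 2 * (∑ s, ∑ b, ∑ s', μ s * π s b * M.trans s b s' * v s' ^ 2) +
        (γ / 2 - 1) * ∑ s, ∑ b, ∑ s', μ s * π s b * M.trans s b s' * v s ^ 2 := by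
    simp only [Finset.mul_sum, ← Finset.sum_add_distrib]
    refine Finset.sum_le_sum fun s _ => Finset.sum_le_sum fun b _ => Finset.sum_le_sum fun s' _ => ?_
    have : (γ * v s' - v s) * v s ≤ γ / 2 * v s' ^ 2 + (γ / 2 - 1) * v s ^ 2 := by
      nlinarith [mul_nonneg hγ0 (sq_nonneg (v s' - v s))]
    calc _ ≤ μ s * π s b * M.trans s b s' * (γ / 2 * v s' ^ 2 + (γ / 2 - 1) * v s ^ 2) :=
          mul_le_mul_of_nonneg_left this (hp s b s')
      _ = _ := by ring
  have h5 := lambdaMin_mul_sq_le (μ := μ) (φ := φ) (w - wStar)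
  rw [h2, h3] at h4
  rw [h1]
  refine h4.trans ?_
  nlinarith [mul_le_mul_of_nonneg_left h5 (sub_nonneg.2 hγ1)]

end MeanDirection

/-! ### One update of implicit TD(0) -/

section Step

variable {X A : Type*} [Fintype X] [Fintype A] {d : ℕ} {M : MDP X A} {γ : ℝ}
  {φ : X → EuclideanSpace ℝ (Fin d)}

lemma abs_tdError_le (hγ0 : 0 ≤ γ) (hγ1 : γ ≤ 1) (hφ : ∀ s, ‖φ s‖ ≤ 1) {B : ℝ}
    {w : EuclideanSpace ℝ (Fin d)} (hw : ‖w‖ ≤ B) (s : X) (b : A) (s' : X) :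
    |tdError M γ φ w s b s'| ≤ (∑ s, ∑ b, |M.reward s b|) + 2 * B := by
  have hr : |M.reward s b| ≤ ∑ s, ∑ b, |M.reward s b| :=
    (Finset.single_le_sum (f := fun b => |M.reward s b|) (fun _ _ => abs_nonneg _)
      (Finset.mem_univ b)).trans (Finset.single_le_sum (f := fun s => ∑ b, |M.reward s b|)
        (fun _ _ => Finset.sum_nonneg fun _ _ => abs_nonneg _) (Finset.mem_univ s))
  have hi : ∀ s, |inner ℝ (φ s) w| ≤ B := fun s =>
    (abs_real_inner_le_norm _ _).trans
      ((mul_le_of_le_one_left (norm_nonneg _) (hφ s)).trans hw)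
  have hB : 0 ≤ B := (norm_nonneg w).trans hw
  have hg : |γ * inner ℝ (φ s') w| ≤ B := by
    rw [abs_mul, abs_of_nonneg hγ0]
    exact (mul_le_of_le_one_left (abs_nonneg _) hγ1).trans (hi s')
  have h1 := abs_le.1 hr
  have h2 := abs_le.1 hg
  have h3 := abs_le.1 (hi s)
  rw [tdError, abs_le]
  constructor <;> linarith

lemma implicit_size_bounds {β p : ℝ} (hβ : 0 ≤ β) (hp0 : 0 ≤ p) (hp1 : p ≤ 1) :
    0 ≤ β / (1 + β * p) ∧ β / (1 + β * p) ≤ β ∧ β - β / (1 + β * p) ≤ β ^ 2 := by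
  have h0 : 0 ≤ β * p := mul_nonneg hβ hp0
  have h1 : 0 < 1 + β * p := by linarith
  refine ⟨by positivity, div_le_self hβ (by linarith), ?_⟩
  rw [sub_le_comm, le_div_iff₀ h1]
  nlinarith [mul_le_mul_of_nonneg_left hp1 (mul_nonneg hβ hβ), mul_nonneg h0 (mul_nonneg hβ hβ)]

lemma norm_projBall_implicitStep_sub_le {R D β : ℝ} (hR : 0 < R) (hβ : 0 ≤ β)
    (hφ : ∀ s, ‖φ s‖ ≤ 1) {w : EuclideanSpace ℝ (Fin d)} (hw : ‖w‖ ≤ R) {s s' : X} {b : A}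
    (hD : |tdError M γ φ w s b s'| ≤ D) :
    ‖projBall R (implicitStep M γ φ β w s b s') - w‖ ≤ D * β := by
  obtain ⟨h0, h1, -⟩ := implicit_size_bounds hβ (sq_nonneg ‖φ s‖)
    (pow_le_one₀ (norm_nonneg _) (hφ s))
  refine (norm_projBall_sub_le hR _ hw).trans ?_
  rw [implicitStep, add_sub_cancel_left, norm_smul, Real.norm_eq_abs, abs_mul, abs_of_nonneg h0,
    mul_comm D]
  exact (mul_le_of_le_one_right (by positivity) (hφ s)).trans
    (mul_le_mul h1 hD (abs_nonneg _) hβ)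

/-- The implicit step size `β / (1 + β ‖φ‖²)` differs from `β` by at most `β²`, so that one update
acts on the squared error like an explicit one, up to a second-order term. -/
lemma sq_norm_projBall_implicitStep_le {R D B β : ℝ} (hR : 0 < R) (hβ : 0 ≤ β)
    (hφ : ∀ s, ‖φ s‖ ≤ 1) {w wStar : EuclideanSpace ℝ (Fin d)} (hwR : ‖wStar‖ ≤ R) {s s' : X}
    {b : A} (hD : |tdError M γ φ w s b s'| ≤ D) (hB : ‖w - wStar‖ ≤ B) :
    ‖projBall R (implicitStep M γ φ β w s b s') - wStar‖ ^ 2 ≤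
      ‖w - wStar‖ ^ 2 + 2 * β * tdInner M γ φ wStar w s b s' + (2 * (D * B) + D ^ 2) * β ^ 2 := by
  have hp1 : ‖φ s‖ ^ 2 ≤ 1 := pow_le_one₀ (norm_nonneg _) (hφ s)
  obtain ⟨h0, h1, h2⟩ := implicit_size_bounds hβ (sq_nonneg ‖φ s‖) hp1
  have hq : |tdInner M γ φ wStar w s b s'| ≤ D * B := by
    rw [tdInner, abs_mul]
    exact mul_le_mul hD ((abs_real_inner_le_norm _ _).trans
      ((mul_le_of_le_one_left (norm_nonneg _) (hφ s)).trans hB)) (abs_nonneg _)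
      ((abs_nonneg _).trans hD)
  refine (pow_le_pow_left₀ (norm_nonneg _) (norm_projBall_sub_le hR _ hwR) 2).trans ?_
  rw [implicitStep, add_sub_right_comm, norm_add_sq_real, inner_smul_right, norm_smul, mul_pow,
    Real.norm_eq_abs, sq_abs, real_inner_comm]
  unfold tdInner at hq ⊢
  set η := β / (1 + β * ‖φ s‖ ^ 2)
  set δ := tdError M γ φ w s b s'
  set i := inner ℝ (φ s) (w - wStar)
  have hδ : δ ^ 2 ≤ D ^ 2 := sq_le_sq' (abs_le.1 hD).1 (abs_le.1 hD).2
  have h3 : (η * δ) ^ 2 * ‖φ s‖ ^ 2 ≤ D ^ 2 * β ^ 2 := by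
    refine (mul_le_of_le_one_right (sq_nonneg _) hp1).trans ?_
    rw [mul_pow, mul_comm]
    exact mul_le_mul hδ (pow_le_pow_left₀ h0 h1 2) (sq_nonneg _) (sq_nonneg _)
  have h4 : (β - η) * (-(δ * i)) ≤ β ^ 2 * (D * B) :=
    (mul_le_mul_of_nonneg_left ((neg_le_abs _).trans hq) (by linarith)).trans
      (mul_le_mul_of_nonneg_right h2 ((abs_nonneg _).trans hq))
  linarith

end Step

/-! ### The step-size recursion -/

/-- A finite family of `C¹` functions is Lipschitz on a ball, with a common constant. -/
lemma exists_lipschitz_bound {ι E : Type*} [Fintype ι] [NormedAddCommGroup E] [NormedSpace ℝ E]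
    [ProperSpace E] {f : ι → E → ℝ} (hf : ∀ i, ContDiff ℝ 1 (f i)) (B : ℝ) :
    ∃ L : ℝ, 0 ≤ L ∧ ∀ i w w', ‖w‖ ≤ B → ‖w'‖ ≤ B → |f i w - f i w'| ≤ L * ‖w - w'‖ := by
  have h : ∀ i, ∃ K, LipschitzOnWith K (f i) (Metric.closedBall 0 B) := fun i =>
    ((hf i).locallyLipschitz.locallyLipschitzOn).exists_lipschitzOnWith_of_compact
      (isCompact_closedBall 0 B)
  choose K hK using h
  refine ⟨∑ i, (K i : ℝ), Finset.sum_nonneg fun i _ => (K i).2, fun i w w' hw hw' => ?_⟩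
  have h1 := (hK i).dist_le_mul w (by simpa using hw) w' (by simpa using hw')
  rw [Real.dist_eq, dist_eq_norm] at h1
  exact h1.trans (mul_le_mul_of_nonneg_right
    (Finset.single_le_sum (f := fun i => (K i : ℝ)) (fun i _ => (K i).2) (Finset.mem_univ i))
    (norm_nonneg _))

lemma sum_stepSize_le {c α₁ : ℝ} (hc : 0 < c) (hα₁ : 0 < α₁) (N : ℕ) :
    ∑ i ∈ Finset.range N, α₁ / (α₁ * c * i + 1) ≤ α₁ + (1 + Real.log N) / c := by
  have hpos : ∀ i : ℕ, 0 ≤ α₁ / (α₁ * c * i + 1) := fun i => by positivity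
  have h1 : ∑ i ∈ Finset.range N, α₁ / (α₁ * c * ((i + 1 : ℕ) : ℝ) + 1) ≤
      (1 + Real.log N) / c := by
    have hh := harmonic_le_one_add_log N
    rw [harmonic, Rat.cast_sum] at hh
    rw [le_div_iff₀ hc, Finset.sum_mul]
    refine le_trans (Finset.sum_le_sum fun i _ => ?_) hh
    push_cast
    rw [div_mul_eq_mul_div, div_le_iff₀ (by positivity), inv_mul_eq_div, le_div_iff₀ (by positivity)]
    nlinarith
  calc _ ≤ ∑ i ∈ Finset.range (N + 1), α₁ / (α₁ * c * i + 1) :=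
        Finset.sum_le_sum_of_subset_of_nonneg (Finset.range_mono (Nat.le_succ N))
          fun i _ _ => hpos i
    _ ≤ _ := by
        rw [Finset.sum_range_succ', add_comm]
        refine add_le_add (by simp) h1

/-- A recursion with contraction rate `1 - 2 c β` forgets its start at rate `1 / N`. Dividing it by
`β N = 1 / (c N + 1 / α₁)` gives the differences `U N - U (N + 1)` equal weights, so that they
telescope. -/
lemma exists_log_div_bound {c α₁ K V : ℝ} (hc : 0 < c) (hα₁ : 0 < α₁) (hK : 0 ≤ K)
    {β e U : ℕ → ℝ} (hβ : ∀ N : ℕ, β N = α₁ / (α₁ * c * N + 1)) (he : ∀ N, 0 ≤ e N)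
    (hU : ∀ N, |U N| ≤ V)
    (hrec : ∀ N, e (N + 1) ≤
      e N - 2 * β N * (c * e N) + 2 * β N * (U N - U (N + 1)) + K * β N ^ 2) :
    ∃ C : ℝ, ∀ N : ℕ, 2 ≤ N → e N ≤ C * Real.log N / N := by
  have htel : ∀ N : ℕ, (c * N + 1 / α₁ - c) * e N + 2 * U N ≤
      (1 / α₁ - c) * e 0 + 2 * U 0 + K * ∑ i ∈ Finset.range N, β i := by
    intro N
    induction N with
    | zero => simp
    | succ N ih =>
      obtain ⟨t, ht⟩ : ∃ t, t = c * N + 1 / α₁ := ⟨_, rfl⟩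
      have htpos : 0 < t := by rw [ht]; positivity
      have hβt : β N * t = 1 := by
        rw [hβ, ht]
        field_simp
      have h1 := mul_le_mul_of_nonneg_left (hrec N) htpos.le
      have h2 : t * (e N - 2 * β N * (c * e N) + 2 * β N * (U N - U (N + 1)) + K * β N ^ 2) =
          t * e N - 2 * c * e N + 2 * (U N - U (N + 1)) + K * β N := by
        linear_combination (-2 * c * e N + 2 * (U N - U (N + 1)) + K * β N) * hβt
      rw [Finset.sum_range_succ]
      push_cast
      have h3 := mul_nonneg hc.le (he N)
      rw [show c * ((N : ℝ) + 1) + 1 / α₁ - c = t by rw [ht]; ring]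
      rw [← ht] at ih
      linarith
  obtain ⟨S, hS⟩ : ∃ S, S = |(1 / α₁ - c) * e 0| + 4 * V + K * (α₁ + 1 / c) := ⟨_, rfl⟩
  have hV : 0 ≤ V := (abs_nonneg _).trans (hU 0)
  have hS0 : 0 ≤ S := by rw [hS]; positivity
  have hlog2 : 0 < Real.log 2 := Real.log_pos (by norm_num)
  refine ⟨2 / c * (S / Real.log 2 + K / c), fun N hN => ?_⟩
  have hN' : (2 : ℝ) ≤ N := by exact_mod_cast hN
  have hlog : Real.log 2 ≤ Real.log N := Real.log_le_log (by norm_num) hN'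
  have h1 : ∑ i ∈ Finset.range N, β i ≤ α₁ + (1 + Real.log N) / c := by
    simp_rw [hβ]
    exact sum_stepSize_le hc hα₁ N
  have h2 : (c * N + 1 / α₁ - c) * e N ≤ S + K / c * Real.log N := by
    have ha := htel N
    have hb := mul_le_mul_of_nonneg_left h1 hK
    have hc1 := abs_le.1 (hU N)
    have hc2 := abs_le.1 (hU 0)
    have hd := le_abs_self ((1 / α₁ - c) * e 0)
    have he : K * (α₁ + (1 + Real.log N) / c) = K * (α₁ + 1 / c) + K / c * Real.log N := by ring
    linarith
  have h3 : c * N / 2 * e N ≤ (c * N + 1 / α₁ - c) * e N := by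
    refine mul_le_mul_of_nonneg_right ?_ (he N)
    have : 0 < 1 / α₁ := by positivity
    nlinarith
  have h4 : S ≤ S / Real.log 2 * Real.log N := by
    rw [div_mul_eq_mul_div, le_div_iff₀ hlog2]
    exact mul_le_mul_of_nonneg_left hlog hS0
  rw [le_div_iff₀ (by linarith)]
  calc e N * N = 2 / c * (c * N / 2 * e N) := by field_simp
    _ ≤ 2 / c * ((S / Real.log 2 + K / c) * Real.log N) := by
        refine mul_le_mul_of_nonneg_left ?_ (by positivity)
        linarith
    _ = _ := by ring

/-! ### The mean squared error -/

section MeanSquaredError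

lemma norm_iterate_le {X A : Type*} [Fintype X] [Fintype A] {d : ℕ} {M : MDP X A} {γ : ℝ}
    {φ : X → EuclideanSpace ℝ (Fin d)} {R : ℝ} {w₁ : EuclideanSpace ℝ (Fin d)} {α : ℕ → ℝ} (hR : 0 < R) (s : ℕ → X) (b : ℕ → A) (n : ℕ) :
    ‖iterate M γ φ α R w₁ s b n‖ ≤ max R ‖w₁‖ := by
  cases n with
  | zero => exact le_max_right _ _
  | succ n => exact (norm_projBall_le hR _).trans (le_max_left _ _)

variable {X A : Type*} [Fintype X] [DecidableEq X] [Fintype A] {d : ℕ} {M : MDP X A}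
  {π : X → A → ℝ} {μ : X → ℝ} {γ : ℝ} {φ : X → EuclideanSpace ℝ (Fin d)}
  {wStar : EuclideanSpace ℝ (Fin d)}

/-- The solution `u` of the Poisson equation for `condTDInner` minus its stationary mean, with its
Lipschitz constant `L` in the iterate on the ball of radius `B`. -/
lemma exists_poisson_condTDInner (hπ : IsPolicy π) (hirr : (stateMatrix M π).IsIrreducible)
    (hμ : IsStationary (stateMatrix M π) μ) (B : ℝ) :
    ∃ (u : X → EuclideanSpace ℝ (Fin d) → ℝ) (L : ℝ), 0 ≤ L ∧
      (∀ s w w', ‖w‖ ≤ B → ‖w'‖ ≤ B → |u s w - u s w'| ≤ L * ‖w - w'‖) ∧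
      ∀ w s, condTDInner M π γ φ wStar w s = u s w - (∑ s', stateMatrix M π s s' * u s' w) +
        ∑ s, μ s * condTDInner M π γ φ wStar w s := by
  obtain ⟨Q, hQ⟩ := exists_poisson_solution hirr (sum_stateMatrix hπ) hμ
  obtain ⟨u, hu⟩ : ∃ u : X → EuclideanSpace ℝ (Fin d) → ℝ, ∀ s w, u s w =
      ∑ y, Q s y * (condTDInner M π γ φ wStar w y -
        ∑ z, μ z * condTDInner M π γ φ wStar w z) := ⟨_, fun _ _ => rfl⟩
  have hsm : ∀ s, ContDiff ℝ 1 (u s) := by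
    intro s
    have h := fun y => contDiff_condTDInner (M := M) (π := π) (γ := γ) (φ := φ) (wStar := wStar) y
    rw [funext (hu s)]
    fun_prop
  obtain ⟨L, hL, hL'⟩ := exists_lipschitz_bound hsm B
  refine ⟨u, L, hL, hL', fun w s => ?_⟩
  have h := hQ (fun y => condTDInner M π γ φ wStar w y -
    ∑ z, μ z * condTDInner M π γ φ wStar w z) (by
      simp only [dotProduct, mul_sub, Finset.sum_sub_distrib, ← Finset.sum_mul, hμ.1.2, one_mul,
        sub_self]) s
  simp only [Matrix.mulVec, dotProduct, ← hu] at h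
  linarith

variable {Ω : Type*} [MeasurableSpace Ω] {ℙ : Measure Ω} [IsProbabilityMeasure ℙ]
  {x : ℕ → Ω → X} {a : ℕ → Ω → A} {R : ℝ} {w₁ : EuclideanSpace ℝ (Fin d)} {α : ℕ → ℝ}

/-- The mean squared error after `N` updates is `O(log N / N)`. The bias of the Markovian noise is
a telescoping sum plus the drift of the solution of the Poisson equation, which is of the order of
the step size. -/
lemma IsTrajectory.exists_log_div_bound (htraj : IsTrajectory M π μ ℙ x a) (hπ : IsPolicy π)
    (hirr : (stateMatrix M π).IsIrreducible) (hμ : IsStationary (stateMatrix M π) μ)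
    (hγ0 : 0 < γ) (hγ1 : γ < 1) (hφ : ∀ s, ‖φ s‖ ≤ 1) (hlam : 0 < lambdaMin μ φ)
    (hwStar : meanTD M π μ γ φ wStar = 0) (hR : 0 < R) (hwR : ‖wStar‖ ≤ R)
    {α₁ : ℝ} (hα₁ : 0 < α₁) (hα : α = stepSize α₁ (lambdaMin μ φ) γ) :
    ∃ C : ℝ, ∀ N : ℕ, 2 ≤ N →
      ∫ ω, ‖iterate M γ φ α R w₁ (fun n => x n ω) (fun n => a n ω) N - wStar‖ ^ 2 ∂ℙ ≤
        C * Real.log N / N := by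
  obtain ⟨B, hB⟩ : ∃ B, B = max R ‖w₁‖ := ⟨_, rfl⟩
  obtain ⟨D, hD⟩ : ∃ D, D = (∑ s, ∑ b, |M.reward s b|) + 2 * B := ⟨_, rfl⟩
  have hRB : R ≤ B := hB ▸ le_max_left _ _
  have hD0 : 0 ≤ D := by
    have : 0 ≤ ∑ s, ∑ b, |M.reward s b| :=
      Finset.sum_nonneg fun _ _ => Finset.sum_nonneg fun _ _ => abs_nonneg _
    linarith
  obtain ⟨u, L, hL0, hL, hu⟩ := exists_poisson_condTDInner (φ := φ) (γ := γ) (wStar := wStar)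
    hπ hirr hμ B
  set c := lambdaMin μ φ * (1 - γ) with hc
  have hcpos : 0 < c := mul_pos hlam (by linarith)
  obtain ⟨β, hβ⟩ : ∃ β : ℕ → ℝ, ∀ N, β N = α (N + 1) := ⟨_, fun _ => rfl⟩
  have hβ' : ∀ N : ℕ, β N = α₁ / (α₁ * c * N + 1) := fun N => by
    rw [hβ, hα, stepSize, hc]
    push_cast
    ring_nf
  have hβpos : ∀ N, 0 < β N := fun N => by
    rw [hβ']
    positivity
  obtain ⟨y, hy⟩ : ∃ y : ℕ → Ω → EuclideanSpace ℝ (Fin d), ∀ N ω,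
      y N ω = iterate M γ φ α R w₁ (fun n => x n ω) (fun n => a n ω) N := ⟨_, fun _ _ => rfl⟩
  have hint : ∀ (N : ℕ) (G : EuclideanSpace ℝ (Fin d) → X → A → X → ℝ),
      Integrable (fun ω => G (y N ω) (x (N + 1) ω) (a (N + 1) ω) (x (N + 2) ω)) ℙ := by
    intro N G
    simp_rw [hy]
    exact htraj.integrable_iterate N G
  have hcond : ∀ (N : ℕ) (G : EuclideanSpace ℝ (Fin d) → X → A → X → ℝ),
      ∫ ω, G (y N ω) (x (N + 1) ω) (a (N + 1) ω) (x (N + 2) ω) ∂ℙ =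
        ∫ ω, ∑ b, ∑ s', π (x (N + 1) ω) b * M.trans (x (N + 1) ω) b s' *
          G (y N ω) (x (N + 1) ω) b s' ∂ℙ := by
    intro N G
    simp_rw [hy]
    exact htraj.integral_transition hπ N G
  have hyB : ∀ N ω, ‖y N ω‖ ≤ B := fun N ω => by
    rw [hy, hB]
    exact norm_iterate_le hR _ _ N
  have hyS : ∀ N ω, y (N + 1) ω = projBall R (implicitStep M γ φ (β N) (y N ω)
      (x (N + 1) ω) (a (N + 1) ω) (x (N + 2) ω)) := fun N ω => by
    rw [hy, hy, hβ]
    rfl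
  have hδ : ∀ N ω, |tdError M γ φ (y N ω) (x (N + 1) ω) (a (N + 1) ω) (x (N + 2) ω)| ≤ D :=
    fun N ω => hD ▸ abs_tdError_le hγ0.le hγ1.le hφ (hyB N ω) _ _ _
  -- The initial guess may lie outside the ball, so that the projection can move it by more than
  -- `D * β 0`; the term `2 * B / α₁` takes care of this.
  have hmove : ∀ N ω, ‖y (N + 1) ω - y N ω‖ ≤ (D + 2 * B / α₁) * β N := by
    intro N ω
    have hB0 : 0 ≤ 2 * B / α₁ := div_nonneg (by linarith) hα₁.le
    rw [add_mul]
    cases N with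
    | zero =>
      have h1 := norm_sub_le (y 1 ω) (y 0 ω)
      have h2 : 2 * B / α₁ * β 0 = 2 * B := by
        rw [hβ']
        field_simp
        simp
      have h3 := mul_nonneg hD0 (hβpos 0).le
      linarith [hyB 1 ω, hyB 0 ω]
    | succ N =>
      have hyR : ‖y (N + 1) ω‖ ≤ R := by
        rw [hyS]
        exact norm_projBall_le hR _
      rw [hyS (N + 1)]
      exact (norm_projBall_implicitStep_sub_le hR (hβpos _).le hφ hyR (hδ (N + 1) ω)).trans
        (le_add_of_nonneg_right (mul_nonneg hB0 (hβpos _).le))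
  obtain ⟨e, he⟩ : ∃ e : ℕ → ℝ, ∀ N, e N = ∫ ω, ‖y N ω - wStar‖ ^ 2 ∂ℙ := ⟨_, fun _ => rfl⟩
  obtain ⟨U, hU⟩ : ∃ U : ℕ → ℝ, ∀ N, U N = ∫ ω, u (x (N + 1) ω) (y N ω) ∂ℙ := ⟨_, fun _ => rfl⟩
  have hUbd : ∀ N, |U N| ≤ (∑ s, |u s 0|) + L * B := by
    intro N
    rw [hU, ← Real.norm_eq_abs]
    refine (norm_integral_le_of_norm_le_const (C := (∑ s, |u s 0|) + L * B)
      (Eventually.of_forall fun ω => ?_)).trans (by simp)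
    have h1 := hL (x (N + 1) ω) (y N ω) 0 (hyB N ω) (by simpa using hR.le.trans hRB)
    have h2 := Finset.single_le_sum (f := fun s => |u s 0|) (fun _ _ => abs_nonneg _)
      (Finset.mem_univ (x (N + 1) ω))
    have h3 := abs_sub_abs_le_abs_sub (u (x (N + 1) ω) (y N ω)) (u (x (N + 1) ω) 0)
    have h4 := mul_le_mul_of_nonneg_left (hyB N ω) hL0
    rw [sub_zero] at h1
    rw [Real.norm_eq_abs]
    linarith
  have hnoise : ∀ N, ∫ ω, tdInner M γ φ wStar (y N ω) (x (N + 1) ω) (a (N + 1) ω)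
      (x (N + 2) ω) ∂ℙ ≤ U N - U (N + 1) + L * (D + 2 * B / α₁) * β N - c * e N := by
    intro N
    have h1 : ∫ ω, tdInner M γ φ wStar (y N ω) (x (N + 1) ω) (a (N + 1) ω) (x (N + 2) ω) ∂ℙ =
        ∫ ω, condTDInner M π γ φ wStar (y N ω) (x (N + 1) ω) ∂ℙ :=
      hcond N (tdInner M γ φ wStar)
    have h2 : ∫ ω, u (x (N + 2) ω) (y N ω) ∂ℙ =
        ∫ ω, ∑ s', stateMatrix M π (x (N + 1) ω) s' * u s' (y N ω) ∂ℙ := by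
      rw [hcond N fun w _ _ s' => u s' w]
      refine integral_congr_ae (Eventually.of_forall fun ω => ?_)
      simp only [stateMatrix, Matrix.of_apply, Finset.sum_mul]
      exact Finset.sum_comm
    have h3 : U (N + 1) - L * (D + 2 * B / α₁) * β N ≤ ∫ ω, u (x (N + 2) ω) (y N ω) ∂ℙ := by
      have h31 := hint (N + 1) fun w s _ _ => u s w
      have hconst : ∫ _, L * (D + 2 * B / α₁) * β N ∂ℙ = L * (D + 2 * B / α₁) * β N := by simp
      rw [hU, ← hconst, ← integral_sub h31 (integrable_const _)]
      refine integral_mono (h31.sub (integrable_const _)) (hint N fun w _ _ s' => u s' w)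
        fun ω => ?_
      have h4 := (le_abs_self _).trans (hL (x (N + 2) ω) _ _ (hyB (N + 1) ω) (hyB N ω))
      have h5 := mul_le_mul_of_nonneg_left (hmove N ω) hL0
      linarith
    have i1 := hint N fun w s _ _ => u s w
    have i2 := hint N fun w s _ _ => ∑ s', stateMatrix M π s s' * u s' w
    have i3 := hint N fun w s _ _ => ∑ z, μ z * condTDInner M π γ φ wStar w z
    have h6 : ∫ ω, ∑ z, μ z * condTDInner M π γ φ wStar (y N ω) z ∂ℙ ≤ -(c * e N) := by
      rw [he, ← integral_const_mul, ← integral_neg]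
      exact integral_mono i3 (hint N fun w _ _ _ => -(c * ‖w - wStar‖ ^ 2))
        fun ω => sum_mul_condTDInner_le hπ hμ hγ0.le hγ1.le hwStar _
    rw [h1]
    simp_rw [fun ω => hu (y N ω) (x (N + 1) ω)]
    have i4 := hint N fun w s _ _ => u s w - ∑ s', stateMatrix M π s s' * u s' w
    rw [integral_add i4 i3, integral_sub i1 i2, ← h2, ← hU]
    linarith
  have hrec : ∀ N, e (N + 1) ≤ e N - 2 * β N * (c * e N) + 2 * β N * (U N - U (N + 1)) +
      (2 * L * (D + 2 * B / α₁) + (2 * (D * (2 * B)) + D ^ 2)) * β N ^ 2 := by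
    intro N
    have i1 := hint N fun w _ _ _ => ‖w - wStar‖ ^ 2
    have i2 := (hint N (tdInner M γ φ wStar)).const_mul (2 * β N)
    have h1 : e (N + 1) ≤ e N + 2 * β N * (∫ ω, tdInner M γ φ wStar (y N ω) (x (N + 1) ω)
        (a (N + 1) ω) (x (N + 2) ω) ∂ℙ) + (2 * (D * (2 * B)) + D ^ 2) * β N ^ 2 := by
      have hconst : ∫ _, (2 * (D * (2 * B)) + D ^ 2) * β N ^ 2 ∂ℙ =
        (2 * (D * (2 * B)) + D ^ 2) * β N ^ 2 := by simp
      have i3 := hint N fun w s b s' =>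
        ‖w - wStar‖ ^ 2 + 2 * β N * tdInner M γ φ wStar w s b s'
      rw [he, he, ← integral_const_mul, ← hconst, ← integral_add i1 i2,
        ← integral_add i3 (integrable_const _)]
      refine integral_mono (hint (N + 1) fun w _ _ _ => ‖w - wStar‖ ^ 2)
        (i3.add (integrable_const _)) fun ω => ?_
      have hdist : ‖y N ω - wStar‖ ≤ 2 * B := by
        have := norm_sub_le (y N ω) wStar
        linarith [hyB N ω]
      simp only [hyS N ω]
      exact sq_norm_projBall_implicitStep_le hR (hβpos N).le hφ hwR (hδ N ω) hdist
    have h2 := mul_le_mul_of_nonneg_left (hnoise N) (mul_nonneg zero_le_two (hβpos N).le)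
    linarith
  have hK : 0 ≤ 2 * L * (D + 2 * B / α₁) + (2 * (D * (2 * B)) + D ^ 2) := by
    have hB0 : 0 ≤ B := hR.le.trans hRB
    positivity
  obtain ⟨C, hC⟩ := ImplicitTD.exists_log_div_bound hcpos hα₁ hK hβ'
    (fun N => he N ▸ integral_nonneg fun _ => sq_nonneg _) hUbd hrec
  refine ⟨C, fun N hN => ?_⟩
  have h := hC N hN
  rw [he] at h
  simp_rw [hy] at h
  exact h

end MeanSquaredError

lemma two_le_of_mixingTime_lt {m ρ ε : ℝ} (hm : 0 < m) (hρ0 : 0 < ρ) (hρ1 : ρ < 1) (hε : 0 < ε)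
    {N : ℕ} (hN : mixingTime m ρ ε < N) : 2 ≤ N := by
  obtain ⟨n, hn⟩ := exists_pow_lt_of_lt_one (div_pos hε hm) hρ1
  have hne : {n : ℕ | 1 ≤ n ∧ m * ρ ^ n ≤ ε}.Nonempty := by
    refine ⟨n + 1, Nat.succ_le_succ n.zero_le, ?_⟩
    have h1 : ρ ^ (n + 1) ≤ ρ ^ n := pow_le_pow_of_le_one hρ0.le hρ1.le n.le_succ
    rw [lt_div_iff₀ hm] at hn
    nlinarith
  have h := (Nat.sInf_mem hne).1
  unfold mixingTime at hN
  omega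

end ImplicitTD

/-- Convergence of projected implicit TD(0) with decreasing step sizes. Here
`iterate … N` is the iterate `w_{N+1}`. -/
theorem theorem4 {X A : Type*} [Fintype X] [DecidableEq X] [Fintype A] {d : ℕ}
    (M : ImplicitTD.MDP X A) (π : X → A → ℝ) (hπ : ImplicitTD.IsPolicy π)
    (hirr : (ImplicitTD.stateMatrix M π).IsIrreducible)
    (haper : ImplicitTD.IsAperiodic (ImplicitTD.stateMatrix M π))
    (μ : X → ℝ) (hμ : ImplicitTD.IsStationary (ImplicitTD.stateMatrix M π) μ)
    (γ : ℝ) (hγ0 : 0 < γ) (hγ1 : γ < 1)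
    (φ : X → EuclideanSpace ℝ (Fin d)) (hφ : ∀ x, ‖φ x‖ ≤ 1)
    (hrank : (ImplicitTD.featureMatrix φ).rank = d)
    (wStar : EuclideanSpace ℝ (Fin d)) (hwStar : ImplicitTD.meanTD M π μ γ φ wStar = 0)
    (R : ℝ) (hR : 0 < R) (hwR : ‖wStar‖ ≤ R)
    (α₁ : ℝ) (hα₁ : 0 < α₁)
    (α : ℕ → ℝ) (hα : α = ImplicitTD.stepSize α₁ (ImplicitTD.lambdaMin μ φ) γ)
    (w₁ : EuclideanSpace ℝ (Fin d))
    {Ω : Type*} [MeasurableSpace Ω] (ℙ : Measure Ω) [IsProbabilityMeasure ℙ]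
    (x : ℕ → Ω → X) (a : ℕ → Ω → A) (htraj : ImplicitTD.IsTrajectory M π μ ℙ x a)
    (m ρ : ℝ) (hm : 0 < m) (hρ0 : 0 < ρ) (hρ1 : ρ < 1)
    (err : ℕ → Ω → ℝ)
    (herr : ∀ N ω, err N ω =
      ‖ImplicitTD.iterate M γ φ α R w₁ (fun n => x n ω) (fun n => a n ω) N - wStar‖ ^ 2) :
    (∀ N, Integrable (err N) ℙ) ∧
    (∃ (C : ℝ) (k : ℕ), ∀ N : ℕ, ImplicitTD.mixingTime m ρ (α N) < N →
      ∫ ω, err N ω ∂ℙ ≤ C * Real.log N ^ k / N) ∧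
    Tendsto (fun N => ∫ ω, err N ω ∂ℙ) atTop (𝓝 0) := by
  have hint : ∀ N, Integrable (err N) ℙ := fun N => by
    rw [funext (herr N)]
    exact htraj.integrable_iterate N fun w _ _ _ => ‖w - wStar‖ ^ 2
  rcases Nat.eq_zero_or_pos d with rfl | hd
  · have hzero : ∀ N, ∫ ω, err N ω ∂ℙ = 0 := fun N => by
      have h0 : ∀ ω, err N ω = 0 := fun ω => by
        rw [herr, Subsingleton.elim (ImplicitTD.iterate _ _ _ _ _ _ _ _ _) wStar]
        simp
      simp [h0]
    refine ⟨hint, ⟨0, 0, fun N _ => by simp [hzero]⟩, ?_⟩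
    simp only [hzero]
    exact tendsto_const_nhds
  have hlam := ImplicitTD.lambdaMin_pos (hμ.pos hirr) hrank hd
  obtain ⟨C, hC⟩ := htraj.exists_log_div_bound (w₁ := w₁) hπ hirr hμ hγ0 hγ1 hφ hlam hwStar hR hwR
    hα₁ hα
  simp_rw [← herr] at hC
  refine ⟨hint, ⟨C, 1, fun N hN => ?_⟩, ?_⟩
  · have hαN : 0 < α N := by
      have hN1 : (1 : ℝ) ≤ N := by exact_mod_cast (Nat.zero_le _).trans_lt hN
      have h1 : 0 ≤ α₁ * ImplicitTD.lambdaMin μ φ * (1 - γ) * ((N : ℝ) - 1) :=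
        mul_nonneg (mul_nonneg (mul_nonneg hα₁.le hlam.le) (by linarith)) (by linarith)
      rw [hα, ImplicitTD.stepSize]
      exact div_pos hα₁ (by linarith)
    simpa using hC N (ImplicitTD.two_le_of_mixingTime_lt hm hρ0 hρ1 hαN hN)
  · have hlim : Tendsto (fun N : ℕ => C * Real.log N / N) atTop (𝓝 0) := by
      have h := ((Real.tendsto_pow_log_div_mul_add_atTop 1 0 1 one_ne_zero).comp
        tendsto_natCast_atTop_atTop).const_mul C
      simpa [Function.comp_def, mul_div_assoc] using h
    refine squeeze_zero' (Eventually.of_forall fun N => integral_nonneg fun ω => ?_)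
      (eventually_atTop.2 ⟨2, hC⟩) hlim
    rw [herr]
    positivity
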